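/- **Notation.** Let $\Lambda$ be the ring of symmetric functions with complex coefficients, a polynomial ring in the power sums $p_1,p_2,\dots$. For a class function $f$ on the symmetric group $S_n$ let $\mathrm{ch}(f)=\frac1{n!}\sum_{w\in S_n} f(w)\,p_{\lambda(w)}$, where $\lambda(w)$ is the cycle type of $w$ and $p_\lambda=p_{\lambda_1}p_{\lambda_2}\cdots$; this is an isomorphism from the class functions on $S_n$ onto the homogeneous symmetric functions of degree $n$. Let $h_n=\mathrm{ch}(\mathbf 1_{S_n})$ and $e_n=\mathrm{ch}(\epsilon_n)$ be the complete homogeneous and elementary symmetric functions ($\epsilon_n$ is the sign character), let $\chi^\lambda$ be the irreducible character of $S_n$ indexed by the partition $\lambda$ of $n$, so that $\mathrm{ch}(\chi^\lambda)$ is the Schur function $s_\lambda$, and let $f[g]$ denote plethysm. For $j\ge 1$ let $\mathrm{Lie}_{(j)}$ be the character of $S_j$ induced from a linear character of the cyclic group generated by a $j$-cycle $c$ that sends $c$ to a primitive $j$-th root of unity, and let $\pi_j=\mathrm{ch}(\epsilon_j\otimes \mathrm{Lie}_{(j)})$. For a partition $\lambda$ of $n$ with $m_j$ parts of size $j$ ($j\ge1$),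 let $\mathrm W_\lambda$ be the character of $S_n$ with $$\mathrm{ch}(\mathrm W_\lambda)=\prod_{j\ \mathrm{odd}} h_{m_j}[\pi_j]\ \prod_{j\ \mathrm{even}} e_{m_j}[\pi_j],$$ and let $\mathrm{rank}(\lambda)=\sum_k(\lambda_k-1)$. For $i\ge 0$ put $\widehat{\mathrm W}^i_n=\sum_\lambda \mathrm W_\lambda$, the sum over all partitions $\lambda$ of $n$ with $\mathrm{rank}(\lambda)=i$ and no parts of size $1$. **Theorem.** For every $n\ge 2$, only finitely many of the characters $\widehat{\mathrm W}^i_n$ $(i\ge0)$ are nonzero, and, as virtual characters of $S_n$, $$\sum_{i\ge 0}(-1)^i\,\widehat{\mathrm W}^i_n=(-1)^{n-1}\chi^{(2,1^{n-2})}.$$ -/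

import Mathlib

noncomputable section

namespace SymmChar

open MvPolynomial

/-! ## Symmetric functions with complex coefficients

The ring of symmetric functions with complex coefficients is the polynomial ring `ℂ[p₁, p₂, …]`
in the (algebraically independent) power sums; the variable of index `d : ℕ+` is `p_d`. -/

/-- The ring `Λ_ℂ = ℂ[p₁, p₂, p₃, …]` of symmetric functions with complex coefficients. -/
abbrev SymFn : Type := MvPolynomial ℕ+ ℂ

/-- The power sum `p_d`, for `d ≥ 1`. (The value at `d = 0` is irrelevant: it is only used at the
parts of partitions.) -/
def psum (d : ℕ) : SymFn := X d.toPNat'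

/-- The exponent vector of the monomial `p_λ`, for a multiset `λ` of positive integers:
the exponent of `p_d` is the number of parts of `λ` equal to `d`. -/
def expo (s : Multiset ℕ) : ℕ+ →₀ ℕ := Multiset.toFinsupp (s.map Nat.toPNat')

/-- `p_λ = p_{λ₁} p_{λ₂} ⋯`. -/
def psumProd (s : Multiset ℕ) : SymFn := (s.map psum).prod

/-- Plethysm `f[g]`: for fixed `g`, the `ℂ`-algebra endomorphism `f ↦ f[g]` for which
`p_m[g]` is obtained from `g` by replacing every variable `x_i` with `x_i ^ m`, that is, by replacing
every `p_k` with `p_{mk}`. -/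
def plethysm (f g : SymFn) : SymFn :=
  aeval (fun m : ℕ+ => aeval (fun k : ℕ+ => (X (m * k) : SymFn)) g) f

/-! ## The Frobenius characteristic -/

/-- The parts (with the parts equal to `1`, one for every fixed point) of the cycle type `λ(w)`
of a permutation. -/
def cycleParts {n : ℕ} (w : Equiv.Perm (Fin n)) : Multiset ℕ := w.partition.parts

/-- The Frobenius characteristic `ch f = (1 / n!) ∑_{w ∈ S_n} f(w) p_{λ(w)}`. -/
def ch (n : ℕ) (f : Equiv.Perm (Fin n) → ℂ) : SymFn :=
  C ((n.factorial : ℂ)⁻¹) * ∑ w : Equiv.Perm (Fin n), C (f w) * psumProd (cycleParts w)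

/-- The inverse of `ch`: the class function on `S_n` with a given Frobenius characteristic `F`
(homogeneous of degree `n`). As `ch f = ∑_λ f(λ) p_λ / z_λ`, its value at `w` is the coefficient of
`p_{λ(w)}` in `F` times the order `z_{λ(w)}` of the centralizer of `w`.
It is inverse to `ch` by `ch_chInv` and `chInv_ch` below. -/
def chInv (n : ℕ) (F : SymFn) : Equiv.Perm (Fin n) → ℂ := fun w =>
  (Nat.card (Subgroup.centralizer {w} : Subgroup (Equiv.Perm (Fin n))) : ℂ) *
    coeff (expo (cycleParts w)) F

/-- The symmetric function `F` is homogeneous of degree `n` (where `p_d` has degree `d`). -/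
def IsHomog (F : SymFn) (n : ℕ) : Prop := IsWeightedHomogeneous (fun d : ℕ+ => (d : ℕ)) F n

/-- Complete homogeneous symmetric function `h_n`, the Frobenius characteristic of the trivial
character of `S_n`; that is, `h_n = ∑_{|λ| = n} p_λ / z_λ`. -/
def hsymm (n : ℕ) : SymFn := ch n (fun _ => 1)

/-- Elementary symmetric function `e_n`, the Frobenius characteristic of the sign
character of `S_n`. -/
def esymm (n : ℕ) : SymFn := ch n (fun w => ((Equiv.Perm.sign w : ℤ) : ℂ))

/-- `e_k` for an integer `k`, with `e_k = 0` for `k < 0`. -/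
def esymmZ (k : ℤ) : SymFn := if k < 0 then 0 else esymm k.toNat

/-! ## Irreducible characters -/

/-- The Schur function `s_λ = det (e_{λᵗ_i - i + j})_{1 ≤ i, j ≤ λ_1}`, where `λᵗ_i` is the length of
the `i`-th column of the diagram of `λ`. -/
def schur (μ : YoungDiagram) : SymFn :=
  Matrix.det (Matrix.of fun i j : Fin (μ.rowLen 0) =>
    esymmZ ((μ.colLen (i : ℕ) : ℤ) - ((i : ℕ) : ℤ) + ((j : ℕ) : ℤ)))

/-- The irreducible character `χ^λ` of `S_n`, for a partition `λ` of `n`: the class function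
on `S_n` whose Frobenius characteristic is the Schur function `s_λ`. -/
def irrChar (n : ℕ) (μ : YoungDiagram) : Equiv.Perm (Fin n) → ℂ := chInv n (schur μ)

theorem hookRows_sorted (k : ℕ) : (2 :: List.replicate k 1).SortedGE := by
  rw [List.sortedGE_iff_pairwise, List.pairwise_cons]
  refine ⟨fun a ha => ?_, ?_⟩
  · rw [List.eq_of_mem_replicate ha]; norm_num
  · exact List.pairwise_replicate.2 (Or.inr le_rfl)

/-- The diagram of the partition `(2, 1^k) = (2, 1, …, 1)`, of size `k + 2`. -/
def hookTwo (k : ℕ) : YoungDiagram :=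
  YoungDiagram.ofRowLens (2 :: List.replicate k 1) (hookRows_sorted k)

theorem hookTwo_rowLens (k : ℕ) : (hookTwo k).rowLens = 2 :: List.replicate k 1 :=
  YoungDiagram.rowLens_ofRowLens_eq_self fun x hx => by
    rcases List.mem_cons.1 hx with rfl | h
    · norm_num
    · rw [List.eq_of_mem_replicate h]; norm_num

/-! ## Lie characters, the characters `W_λ`, and `Ŵ^i_n` -/

/-- The Lie character `Lie_(n)` of `S_n`, for `n ≥ 1`: the linear character of the cyclic group
`C_n = {1, c, …, c^{n-1}}` generated by an `n`-cycle `c` that sends `c` to the primitive `n`-th root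
of unity `ζ = exp (2πi / n)`, induced up to `S_n`. -/
def lieChar (n : ℕ) (w : Equiv.Perm (Fin n)) : ℂ :=
  (n : ℂ)⁻¹ * ∑ g : Equiv.Perm (Fin n), ∑ k ∈ Finset.range n,
    if g⁻¹ * w * g = finRotate n ^ k then
      Complex.exp (2 * Real.pi * Complex.I / n) ^ k else 0

/-- `π_n = ch (ε ⊗ Lie_(n))`, where `ε` is the sign character of `S_n`. -/
def piSym (n : ℕ) : SymFn :=
  ch n (fun w => ((Equiv.Perm.sign w : ℤ) : ℂ) * lieChar n w)

/-- The symmetric function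
`∏_{j odd} h_{m_j}[π_j] · ∏_{j even} e_{m_j}[π_j]`, where `m_j` is the number of parts of size `j`
of the partition `λ` of `n`. -/
def wSym {n : ℕ} (lam : n.Partition) : SymFn :=
  ∏ j ∈ Finset.Icc 1 n,
    if Odd j then plethysm (hsymm (lam.parts.count j)) (piSym j)
    else plethysm (esymm (lam.parts.count j)) (piSym j)

/-- The character `W_λ` of `S_n`, the one with Frobenius characteristic `wSym λ`
(see `ch_wChar`). -/
def wChar {n : ℕ} (lam : n.Partition) : Equiv.Perm (Fin n) → ℂ := chInv n (wSym lam)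

/-- The rank `∑_k (λ_k - 1)` of a partition. -/
def partRank {n : ℕ} (lam : n.Partition) : ℕ := (lam.parts.map fun a => a - 1).sum

/-- The character `Ŵ^i_n = ∑_λ W_λ` of `S_n`, the sum over all the partitions `λ` of `n` of rank `i`
without parts of size `1`. -/
def wHat (n i : ℕ) : Equiv.Perm (Fin n) → ℂ :=
  ∑ lam : n.Partition with 1 ∉ lam.parts ∧ partRank lam = i, wChar lam

/-! ## The characters defined through `ch` have the right Frobenius characteristics -/

theorem psumProd_eq (s : Multiset ℕ) : psumProd s = monomial (expo s) (1 : ℂ) := by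
  induction s using Multiset.induction_on with
  | empty => simp [psumProd, expo]
  | cons a s ih =>
    have h1 : psumProd (a ::ₘ s) = psum a * psumProd s := by simp [psumProd]
    have h2 : expo (a ::ₘ s) = Finsupp.single a.toPNat' 1 + expo s := by
      simp [expo, ← Multiset.singleton_add]
    rw [h1, h2, ih, psum, X, monomial_mul, one_mul]

theorem cycleParts_pos {n : ℕ} (w : Equiv.Perm (Fin n)) {a : ℕ} (h : a ∈ cycleParts w) : 0 < a :=
  w.partition.parts_pos h

theorem cycleParts_sum {n : ℕ} (w : Equiv.Perm (Fin n)) : (cycleParts w).sum = n := by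
  rw [cycleParts, w.partition.parts_sum, Fintype.card_fin]

theorem map_toPNat' (s : Multiset ℕ) (h : ∀ a ∈ s, 0 < a) :
    (s.map Nat.toPNat').map (fun d : ℕ+ => (d : ℕ)) = s := by
  rw [Multiset.map_map]
  conv_rhs => rw [← Multiset.map_id s]
  refine Multiset.map_congr rfl fun a ha => ?_
  have := h a ha
  simp [Nat.toPNat'_coe, this]

theorem expo_inj {s t : Multiset ℕ} (hs : ∀ a ∈ s, 0 < a) (ht : ∀ a ∈ t, 0 < a)
    (h : expo s = expo t) : s = t := by
  have h' := Multiset.toFinsupp.injective h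
  rw [← map_toPNat' s hs, ← map_toPNat' t ht, h']

theorem weight_expo (s : Multiset ℕ) (h : ∀ a ∈ s, 0 < a) :
    Finsupp.weight (fun d : ℕ+ => (d : ℕ)) (expo s) = s.sum := by
  induction s using Multiset.induction_on with
  | empty => simp [expo]
  | cons a s ih =>
    have h2 : expo (a ::ₘ s) = Finsupp.single a.toPNat' 1 + expo s := by
      simp [expo, ← Multiset.singleton_add]
    rw [h2, map_add, ih fun b hb => h b (Multiset.mem_cons_of_mem hb), Multiset.sum_cons]
    have := h a (Multiset.mem_cons_self a s)
    simp [Finsupp.weight_single, Nat.toPNat'_coe, this]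

theorem cycleParts_eq_iff {n : ℕ} (w v : Equiv.Perm (Fin n)) :
    expo (cycleParts w) = expo (cycleParts v) ↔ IsConj w v := by
  rw [Equiv.Perm.partition_eq_of_isConj, Nat.Partition.ext_iff]
  exact ⟨fun h => expo_inj (fun a => cycleParts_pos w) (fun a => cycleParts_pos v) h,
    fun h => by rw [cycleParts, cycleParts, h]⟩

theorem class_card_mul {n : ℕ} (w : Equiv.Perm (Fin n)) :
    ((Finset.univ.filter fun v : Equiv.Perm (Fin n) =>
      expo (cycleParts v) = expo (cycleParts w)).card : ℂ) *
      (Nat.card (Subgroup.centralizer {w} : Subgroup (Equiv.Perm (Fin n))) : ℂ) =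
      (n.factorial : ℂ) := by
  classical
  have h1 := Equiv.Perm.card_isConj_mul_eq w
  rw [← Equiv.Perm.nat_card_centralizer, Fintype.card_fin] at h1
  rw [← h1, Nat.cast_mul]
  congr 2
  rw [Nat.card_coe_set_eq, ← Set.ncard_coe_finset]
  congr 1
  ext v
  simp only [Finset.coe_filter, Finset.mem_univ, true_and, Set.mem_ofPred_eq, cycleParts_eq_iff]
  exact isConj_comm

theorem exists_cycleParts {n : ℕ} (s : Multiset ℕ) (hs : ∀ a ∈ s, 0 < a) (hn : s.sum = n) :
    ∃ w : Equiv.Perm (Fin n), cycleParts w = s := by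
  classical
  have hsplit : s.filter (2 ≤ ·) + Multiset.replicate (s.count 1) 1 = s := by
    conv_rhs => rw [← Multiset.filter_add_not (2 ≤ ·) s]
    congr 1
    rw [← Multiset.filter_eq']
    refine Multiset.filter_congr fun a ha => ?_
    have := hs a ha
    omega
  have hsum : (s.filter (2 ≤ ·)).sum + s.count 1 = n := by
    rw [← hn]
    conv_rhs => rw [← hsplit]
    simp
  obtain ⟨w, hw⟩ := (Equiv.Perm.exists_with_cycleType_iff (Fin n)
    (m := s.filter (2 ≤ ·))).2 ⟨by rw [Fintype.card_fin]; omega, fun a ha =>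
      (Multiset.mem_filter.1 ha).2⟩
  refine ⟨w, ?_⟩
  rw [cycleParts, Equiv.Perm.parts_partition, ← Equiv.Perm.sum_cycleType, hw, Fintype.card_fin]
  conv_rhs => rw [← hsplit]
  congr 2
  omega

theorem coeff_ch (n : ℕ) (f : Equiv.Perm (Fin n) → ℂ) (a : ℕ+ →₀ ℕ) :
    coeff a (ch n f) = (n.factorial : ℂ)⁻¹ *
      ∑ w : Equiv.Perm (Fin n) with expo (cycleParts w) = a, f w := by
  classical
  simp only [ch, coeff_C_mul, coeff_sum, psumProd_eq, coeff_monomial, Finset.sum_filter,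
    mul_ite, mul_one, mul_zero]

/-- `ch` is inverted by `chInv` on symmetric functions homogeneous of degree `n`. -/
theorem ch_chInv (n : ℕ) (F : SymFn) (hF : IsHomog F n) : ch n (chInv n F) = F := by
  classical
  have hfac : (n.factorial : ℂ) ≠ 0 := by exact_mod_cast n.factorial_ne_zero
  ext a
  rw [coeff_ch]
  by_cases ha : ∃ w : Equiv.Perm (Fin n), expo (cycleParts w) = a
  · obtain ⟨w, rfl⟩ := ha
    have hc : ∀ v ∈ Finset.univ.filter (fun v : Equiv.Perm (Fin n) =>
        expo (cycleParts v) = expo (cycleParts w)), chInv n F v = chInv n F w := by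
      intro v hv
      have hv := (Finset.mem_filter.1 hv).2
      have h1 := class_card_mul v
      have h2 := class_card_mul w
      simp only [hv] at h1
      have h0 : ((Finset.univ.filter fun v : Equiv.Perm (Fin n) =>
          expo (cycleParts v) = expo (cycleParts w)).card : ℂ) ≠ 0 := by
        intro h
        rw [h, zero_mul] at h2
        exact hfac h2.symm
      rw [chInv, chInv, hv, mul_left_cancel₀ h0 (h1.trans h2.symm)]
    rw [Finset.sum_congr rfl hc, Finset.sum_const, nsmul_eq_mul, chInv, ← mul_assoc, ← mul_assoc,
      mul_assoc (_⁻¹), class_card_mul, inv_mul_cancel₀ hfac, one_mul]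
  · have hempty : (Finset.univ.filter fun v : Equiv.Perm (Fin n) => expo (cycleParts v) = a) = ∅ :=
      Finset.filter_eq_empty_iff.2 fun v _ h => ha ⟨v, h⟩
    rw [hempty, Finset.sum_empty, mul_zero]
    symm
    by_contra hne
    have hw := hF hne
    have hexp : expo ((Finsupp.toMultiset a).map (fun d : ℕ+ => (d : ℕ))) = a := by
      rw [expo, Multiset.map_map]
      have : (Finsupp.toMultiset a).map (Nat.toPNat' ∘ fun d : ℕ+ => (d : ℕ)) =
          Finsupp.toMultiset a := by
        conv_rhs => rw [← Multiset.map_id (Finsupp.toMultiset a)]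
        exact Multiset.map_congr rfl fun d _ => by simp
      rw [this]
      simp
    have hpos : ∀ b ∈ (Finsupp.toMultiset a).map (fun d : ℕ+ => (d : ℕ)), 0 < b := by
      intro b hb
      obtain ⟨d, -, rfl⟩ := Multiset.mem_map.1 hb
      exact d.pos
    rw [← hexp, weight_expo _ hpos] at hw
    obtain ⟨w, hw'⟩ := exists_cycleParts _ hpos hw
    exact ha ⟨w, by rw [hw', hexp]⟩

/-- `chInv` inverts `ch` on class functions. -/
theorem chInv_ch (n : ℕ) (f : Equiv.Perm (Fin n) → ℂ) (hf : ∀ v w, IsConj v w → f v = f w) :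
    chInv n (ch n f) = f := by
  classical
  have hfac : (n.factorial : ℂ) ≠ 0 := by exact_mod_cast n.factorial_ne_zero
  funext w
  have hc : ∀ v ∈ Finset.univ.filter (fun v : Equiv.Perm (Fin n) =>
      expo (cycleParts v) = expo (cycleParts w)), f v = f w := fun v hv =>
    hf v w ((cycleParts_eq_iff v w).1 (Finset.mem_filter.1 hv).2)
  rw [chInv, coeff_ch, Finset.sum_congr rfl hc, Finset.sum_const, nsmul_eq_mul]
  have h := class_card_mul w
  field_simp
  rw [← h]
  ring

theorem isHomog_ch (n : ℕ) (f : Equiv.Perm (Fin n) → ℂ) : IsHomog (ch n f) n := by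
  classical
  intro a ha
  rw [coeff_ch] at ha
  by_contra hne
  refine ha ?_
  have hempty : (Finset.univ.filter fun v : Equiv.Perm (Fin n) => expo (cycleParts v) = a) = ∅ := by
    refine Finset.filter_eq_empty_iff.2 fun v _ h => hne ?_
    rw [← h, weight_expo _ (fun a => cycleParts_pos v), cycleParts_sum]
  rw [hempty, Finset.sum_empty, mul_zero]

theorem isHomog_plethysm {f g : SymFn} {m j : ℕ} (hf : IsHomog f m) (hg : IsHomog g j) :
    IsHomog (plethysm f g) (m * j) := by
  have key : ∀ (φ : ℕ+ → SymFn) (c : ℕ) (F : SymFn) (k : ℕ), IsHomog F k →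
      (∀ d : ℕ+, IsHomog (φ d) (d * c)) → IsHomog (aeval φ F) (k * c) := by
    intro φ c F k hF hφ
    rw [aeval_def, eval₂_eq]
    refine IsWeightedHomogeneous.sum _ _ _ fun a ha => ?_
    have hw := hF (mem_support_iff.1 ha)
    have hp : IsHomog (∏ i ∈ a.support, φ i ^ a i) (∑ i ∈ a.support, a i • ((i : ℕ) * c)) :=
      IsWeightedHomogeneous.prod _ _ _ fun i _ => (hφ i).pow (a i)
    have hs : ∑ i ∈ a.support, a i • ((i : ℕ) * c) = k * c := by
      rw [← hw, Finsupp.weight_apply, Finsupp.sum, Finset.sum_mul]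
      simp [mul_assoc]
    rw [hs] at hp
    exact hp.C_mul _
  refine key _ j f m hf fun d => ?_
  rw [mul_comm]
  refine key _ d g j hg fun k => ?_
  have := isWeightedHomogeneous_X ℂ (fun d : ℕ+ => (d : ℕ)) (d * k)
  rw [PNat.mul_coe, mul_comm (d : ℕ)] at this
  exact this

theorem isHomog_wSym {n : ℕ} (lam : n.Partition) : IsHomog (wSym lam) n := by
  have h : IsHomog (wSym lam) (∑ j ∈ Finset.Icc 1 n, lam.parts.count j * j) := by
    refine IsWeightedHomogeneous.prod _ _ _ fun j _ => ?_
    split_ifs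
    · exact isHomog_plethysm (isHomog_ch _ _) (isHomog_ch _ _)
    · exact isHomog_plethysm (isHomog_ch _ _) (isHomog_ch _ _)
  have hs : ∑ j ∈ Finset.Icc 1 n, lam.parts.count j * j = n := by
    conv_rhs => rw [← lam.parts_sum]
    rw [Finset.sum_multiset_count_of_subset lam.parts (Finset.Icc 1 n)]
    · simp
    · intro j hj
      rw [Multiset.mem_toFinset] at hj
      refine Finset.mem_Icc.2 ⟨lam.parts_pos hj, ?_⟩
      rw [← lam.parts_sum]
      exact Multiset.le_sum_of_mem hj
  rwa [hs] at h

theorem ch_wChar {n : ℕ} (lam : n.Partition) : ch n (wChar lam) = wSym lam :=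
  ch_chInv n _ (isHomog_wSym lam)

theorem isHomog_schur (μ : YoungDiagram) : IsHomog (schur μ) μ.card := by
  have hcard : ∑ i : Fin (μ.rowLen 0), μ.colLen (i : ℕ) = μ.card := by
    have h : μ.card = ∑ j ∈ Finset.range (μ.rowLen 0), (μ.col j).card := by
      rw [YoungDiagram.card, Finset.card_eq_sum_card_fiberwise (f := Prod.snd)
        (t := Finset.range (μ.rowLen 0))]
      · rfl
      · intro c hc
        have hc : (c.1, c.2) ∈ μ := hc
        rw [YoungDiagram.mem_iff_lt_rowLen] at hc
        exact Finset.mem_coe.2 (Finset.mem_range.2 (hc.trans_le (μ.rowLen_anti 0 _ (Nat.zero_le _))))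
    rw [h, ← Fin.sum_univ_eq_sum_range]
    simp [YoungDiagram.colLen_eq_card]
  rw [schur, Matrix.det_apply']
  refine IsWeightedHomogeneous.sum _ _ _ fun σ _ => ?_
  have hC : ((Equiv.Perm.sign σ : ℤ) : SymFn) = C (((Equiv.Perm.sign σ : ℤ) : ℂ)) := by simp
  rw [hC]
  refine IsWeightedHomogeneous.C_mul ?_ _
  simp only [Matrix.of_apply]
  by_cases hneg : ∃ i : Fin (μ.rowLen 0),
      (μ.colLen ((σ i : Fin _) : ℕ) : ℤ) - ((σ i : ℕ) : ℤ) + ((i : ℕ) : ℤ) < 0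
  · obtain ⟨i, hi⟩ := hneg
    rw [Finset.prod_eq_zero (Finset.mem_univ i) (by rw [esymmZ, if_pos hi])]
    exact isWeightedHomogeneous_zero _ _ _
  · push Not at hneg
    have hp : IsHomog (∏ i : Fin (μ.rowLen 0), esymmZ
        ((μ.colLen ((σ i : Fin _) : ℕ) : ℤ) - ((σ i : ℕ) : ℤ) + ((i : ℕ) : ℤ)))
        (∑ i : Fin (μ.rowLen 0),
          ((μ.colLen ((σ i : Fin _) : ℕ) : ℤ) - ((σ i : ℕ) : ℤ) + ((i : ℕ) : ℤ)).toNat) := by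
      refine IsWeightedHomogeneous.prod _ _ _ fun i _ => ?_
      rw [esymmZ, if_neg (not_lt.2 (hneg i))]
      exact isHomog_ch _ _
    have hs : ∑ i : Fin (μ.rowLen 0),
        ((μ.colLen ((σ i : Fin _) : ℕ) : ℤ) - ((σ i : ℕ) : ℤ) + ((i : ℕ) : ℤ)).toNat = μ.card := by
      zify
      rw [Finset.sum_congr rfl fun i _ => Int.toNat_of_nonneg (hneg i), Finset.sum_add_distrib,
        Equiv.sum_comp σ (fun i => (μ.colLen (i : ℕ) : ℤ) - ((i : ℕ) : ℤ)),
        ← Finset.sum_add_distrib, ← hcard]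
      simp
    rwa [hs] at hp

/-- The irreducible character `χ^λ` has Frobenius characteristic `s_λ`. -/
theorem ch_irrChar (μ : YoungDiagram) : ch μ.card (irrChar μ.card μ) = schur μ :=
  ch_chInv _ _ (isHomog_schur μ)

end SymmChar

end

/-! Put `U(t) = ∑_n t^n ∑_λ (-1)^{rank λ} ch W_λ`, over partitions without parts 1. Rank and `ch
W_λ` split over part sizes, so `U` is a product over `j ≥ 2`. The sign `(-1)^{(j-1)m}` compensates
for using `e_m` at even `j`, and every factor becomes `exp((-1)^{j-1} ∑_k p_k[π_j] t^{jk} / k)`.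

Hence `t U'/U` has coefficient `∑_{jk=d, j≠1} (-1)^{j-1} j p_k[π_j]` at `t^d`. Grouping the powers
of an `n`-cycle by order gives `j π_j = ∑_{ab=j} μ(a) ((-1)^{a-1} p_a)^b` (`mul_piSym`), where
`μ(a)` enters as the sum of the primitive `a`-th roots of unity. Möbius cancellation
(`sum_mul_adams_piSym`) collapses the sum over all `jk = d` to `(-1)^{d-1} p_1^d`; leaving out `j =
1` subtracts `p_d` (`sum_signedLog`).

This is the logarithmic derivative of `(1 + p_1 t) ∑_n (-1)^n e_n t^n`, so the two series agree
(`mk_partGen_signedFactor`). The coefficient of `t^n` is `(-1)^{n-1} (e_{n-1} e_1 - e_n)`, and the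
bracket is the dual Jacobi–Trudi determinant of `(2, 1^{n-2})`.

Logarithmic derivatives are handled as recurrences of Newton type: `mul_partGen` is the rule that
the logarithmic derivative of a product over `j` is a sum over `j`. -/

noncomputable section

namespace SymmChar

open MvPolynomial

/-! ## Multiplicative functions of partitions -/

section Partitions

variable {R : Type*} [CommSemiring R]

/-- The finite set of the multisets of parts of the partitions of `n`. -/
def partsFinset (n : ℕ) : Finset (Multiset ℕ) :=
  Finset.univ.image fun p : n.Partition => p.parts

theorem mem_partsFinset {n : ℕ} {s : Multiset ℕ} :
    s ∈ partsFinset n ↔ (∀ a ∈ s, 0 < a) ∧ s.sum = n := by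
  simp only [partsFinset, Finset.mem_image, Finset.mem_univ, true_and]
  exact ⟨fun ⟨p, hp⟩ => hp ▸ ⟨fun _ => p.parts_pos, p.parts_sum⟩,
    fun h => ⟨⟨s, fun {i} => h.1 i, h.2⟩, rfl⟩⟩

theorem sum_partsFinset {M : Type*} [AddCommMonoid M] (n : ℕ) (F : Multiset ℕ → M) :
    ∑ s ∈ partsFinset n, F s = ∑ p : n.Partition, F p.parts := by
  rw [partsFinset, Finset.sum_image fun p _ q _ h => Nat.Partition.ext h]

/-- The product of the values of `f j m` over all parts `j` of `s`, with multiplicity `m`. -/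
def multProd (f : ℕ → ℕ → R) (s : Multiset ℕ) : R := ∏ j ∈ s.toFinset, f j (s.count j)

/-- The sum of `multProd f` over the partitions of `n`. -/
def partGen (f : ℕ → ℕ → R) (n : ℕ) : R := ∑ s ∈ partsFinset n, multProd f s

/-- The normalization `f j 0 = 1` lets the factor at `j` be isolated even when `j` is not a part. -/
theorem multProd_eq_mul_filter {f : ℕ → ℕ → R} (hf : ∀ j, f j 0 = 1) (j : ℕ) (s : Multiset ℕ) :
    multProd f s = f j (s.count j) * multProd f (s.filter (· ≠ j)) := by
  have h : multProd f (s.filter (· ≠ j)) = ∏ i ∈ s.toFinset.erase j, f i (s.count i) := by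
    have : (s.filter (· ≠ j)).toFinset = s.toFinset.erase j := by
      ext i; simp [and_comm]
    rw [multProd, this]
    refine Finset.prod_congr rfl fun i hi => ?_
    rw [Multiset.count_filter_of_pos (p := (· ≠ j)) (Finset.ne_of_mem_erase hi)]
  rw [h, multProd]
  by_cases hj : j ∈ s.toFinset
  · rw [Finset.mul_prod_erase _ (fun i => f i (s.count i)) hj]
  · rw [Finset.erase_eq_of_notMem hj, Multiset.count_eq_zero.2 (by simpa using hj), hf, one_mul]

theorem multProd_sub_replicate {f : ℕ → ℕ → R} (hf : ∀ j, f j 0 = 1) (j k : ℕ)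
    (s : Multiset ℕ) : multProd f (s - Multiset.replicate k j) =
      f j (s.count j - k) * multProd f (s.filter (· ≠ j)) := by
  rw [multProd_eq_mul_filter hf j, Multiset.count_sub, Multiset.count_replicate_self]
  congr 2
  ext i
  by_cases hi : i = j
  · simp [hi]
  · rw [Multiset.count_filter_of_pos (p := (· ≠ j)) hi,
      Multiset.count_filter_of_pos (p := (· ≠ j)) hi, Multiset.count_sub,
      Multiset.count_replicate, if_neg (Ne.symm hi), Nat.sub_zero]

theorem count_mul_le_of_mem_partsFinset {n : ℕ} {s : Multiset ℕ} (hs : s ∈ partsFinset n) (j : ℕ) :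
    j * s.count j ≤ n := by
  have h := Multiset.le_count_iff_replicate_le.1 (le_refl (s.count j))
  obtain ⟨t, ht⟩ := Multiset.le_iff_exists_add.1 h
  rw [← (mem_partsFinset.1 hs).2]
  conv_rhs => rw [ht]
  simp [mul_comm]

theorem sum_mul_count {n : ℕ} {s : Multiset ℕ} (hs : s ∈ partsFinset n) :
    ∑ j ∈ Finset.Icc 1 n, j * s.count j = n := by
  obtain ⟨h1, h2⟩ := mem_partsFinset.1 hs
  conv_rhs => rw [← h2]
  rw [Finset.sum_multiset_count_of_subset s (Finset.Icc 1 n)]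
  · simp [mul_comm]
  · intro j hj
    rw [Multiset.mem_toFinset] at hj
    exact Finset.mem_Icc.2 ⟨h1 j hj, h2 ▸ Multiset.le_sum_of_mem hj⟩

/-- Removing `k` copies of `j` is a bijection from the partitions of `n` with at least `k` parts `j`
onto the partitions of `n - j * k`; there are none of the former when `j * k > n`. -/
theorem sum_multProd_sub_replicate (f : ℕ → ℕ → R) {n j k : ℕ} (hj : 0 < j) :
    ∑ s ∈ partsFinset n with k ≤ s.count j, multProd f (s - Multiset.replicate k j) =
      if j * k ≤ n then partGen f (n - j * k) else 0 := by
  split_ifs with h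
  · refine Finset.sum_bij' (fun s _ => s - Multiset.replicate k j)
      (fun s _ => s + Multiset.replicate k j) ?_ ?_ ?_ ?_ ?_
    · intro s hs
      obtain ⟨hs, hk⟩ := Finset.mem_filter.1 hs
      obtain ⟨h1, h2⟩ := mem_partsFinset.1 hs
      refine mem_partsFinset.2 ⟨fun a ha => h1 a (Multiset.mem_of_le (Multiset.sub_le_self _ _) ha),
        ?_⟩
      obtain ⟨t, rfl⟩ := Multiset.le_iff_exists_add.1 (Multiset.le_count_iff_replicate_le.1 hk)
      rw [add_tsub_cancel_left, ← h2]
      simp [mul_comm]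
    · intro s hs
      obtain ⟨h1, h2⟩ := mem_partsFinset.1 hs
      refine Finset.mem_filter.2 ⟨mem_partsFinset.2 ⟨fun a ha => ?_, ?_⟩, by simp⟩
      · rcases Multiset.mem_add.1 ha with ha | ha
        · exact h1 a ha
        · rwa [Multiset.eq_of_mem_replicate ha]
      · rw [Multiset.sum_add, h2, Multiset.sum_replicate, smul_eq_mul, mul_comm k,
          Nat.sub_add_cancel h]
    · intro s hs
      exact Multiset.sub_add_cancel
        (Multiset.le_count_iff_replicate_le.1 (Finset.mem_filter.1 hs).2)
    · intro s _
      simp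
    · intro s _
      rfl
  · refine Finset.sum_eq_zero fun s hs => absurd ?_ h
    obtain ⟨hs, hk⟩ := Finset.mem_filter.1 hs
    exact (Nat.mul_le_mul_left j hk).trans (count_mul_le_of_mem_partsFinset hs j)

theorem partGen_zero (f : ℕ → ℕ → R) : partGen f 0 = 1 := by
  have : partsFinset 0 = {0} := by
    ext s
    rw [mem_partsFinset, Finset.mem_singleton]
    refine ⟨fun ⟨h1, h2⟩ => Multiset.eq_zero_of_forall_notMem fun a ha => ?_, ?_⟩
    · have := Multiset.le_sum_of_mem ha
      have := h1 a ha
      omega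
    · rintro rfl; simp
  simp [partGen, this, multProd]

/-- If, for every `j`, the generating function of `m ↦ f j m` has logarithmic derivative given
by `l j`, then the logarithmic derivative of the generating function of `partGen f` is the sum
of these. -/
theorem mul_partGen {f l : ℕ → ℕ → R} (hf : ∀ j, f j 0 = 1)
    (h : ∀ j : ℕ, 0 < j → ∀ m : ℕ, (j * m : R) * f j m = ∑ k ∈ Finset.Icc 1 m, l j k * f j (m - k))
    (n : ℕ) :
    (n : R) * partGen f n = ∑ d ∈ Finset.Icc 1 n,
      (∑ x ∈ d.divisorsAntidiagonal, l x.1 x.2) * partGen f (n - d) := by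
  -- Write `n` as the sum of `j * s.count j` and apply `h` to the factor at `j`. The range of `k` is
  -- enlarged to one independent of `s`, so that the sums can be interchanged.
  have h1 : (n : R) * partGen f n = ∑ s ∈ partsFinset n, ∑ j ∈ Finset.Icc 1 n,
      ∑ k ∈ Finset.Icc 1 n,
        if k ≤ s.count j then l j k * multProd f (s - Multiset.replicate k j) else 0 := by
    rw [partGen, Finset.mul_sum]
    refine Finset.sum_congr rfl fun s hs => ?_
    have h2 := sum_mul_count hs
    conv_lhs => rw [← h2]
    rw [Nat.cast_sum, Finset.sum_mul]
    refine Finset.sum_congr rfl fun j hj => ?_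
    have hj0 := (Finset.mem_Icc.1 hj).1
    rw [multProd_eq_mul_filter hf j, Nat.cast_mul, ← mul_assoc, h j hj0, Finset.sum_mul,
      ← Finset.sum_filter]
    have h3 : Finset.Icc 1 (s.count j) = (Finset.Icc 1 n).filter (· ≤ s.count j) := by
      have := count_mul_le_of_mem_partsFinset hs j
      have : s.count j ≤ n := (Nat.le_mul_of_pos_left _ hj0).trans this
      ext k
      simp only [Finset.mem_Icc, Finset.mem_filter]
      omega
    rw [h3]
    refine Finset.sum_congr rfl fun k _ => ?_
    rw [multProd_sub_replicate hf, mul_assoc]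
  rw [h1, Finset.sum_comm]
  have h4 : ∀ j ∈ Finset.Icc 1 n, ∑ s ∈ partsFinset n, ∑ k ∈ Finset.Icc 1 n,
        (if k ≤ s.count j then l j k * multProd f (s - Multiset.replicate k j) else 0) =
      ∑ k ∈ Finset.Icc 1 n, if j * k ≤ n then l j k * partGen f (n - j * k) else 0 := by
    intro j hj
    rw [Finset.sum_comm]
    refine Finset.sum_congr rfl fun k _ => ?_
    rw [← Finset.sum_filter, ← Finset.mul_sum,
      sum_multProd_sub_replicate f (Finset.mem_Icc.1 hj).1, mul_ite, mul_zero]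
  rw [Finset.sum_congr rfl h4, ← Finset.sum_product', ← Finset.sum_filter]
  simp only [Finset.sum_mul]
  rw [Finset.sum_sigma']
  -- The pairs `(j, k)` with `j * k ≤ n` are grouped by their product `d`.
  refine Finset.sum_bij' (fun x _ => ⟨x.1 * x.2, x⟩) (fun x _ => x.2) ?_ ?_ ?_ ?_ ?_
  · rintro ⟨j, k⟩ hx
    simp only [Finset.mem_filter, Finset.mem_product, Finset.mem_Icc] at hx
    simp only [Finset.mem_sigma, Finset.mem_Icc, Nat.mem_divisorsAntidiagonal, true_and]
    have := Nat.mul_pos hx.1.1.1 hx.1.2.1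
    omega
  · rintro ⟨d, j, k⟩ hx
    simp only [Finset.mem_sigma, Finset.mem_Icc, Nat.mem_divisorsAntidiagonal] at hx
    obtain ⟨⟨h1, h2⟩, rfl, h0⟩ := hx
    simp only [Finset.mem_filter, Finset.mem_product, Finset.mem_Icc]
    have hj := Nat.pos_of_ne_zero (left_ne_zero_of_mul h0)
    have hk := Nat.pos_of_ne_zero (right_ne_zero_of_mul h0)
    have := Nat.le_mul_of_pos_left k hj
    have := Nat.le_mul_of_pos_right j hk
    omega
  · intro x _; rfl
  · rintro ⟨d, j, k⟩ hx
    simp only [Finset.mem_sigma, Nat.mem_divisorsAntidiagonal] at hx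
    obtain ⟨-, rfl, -⟩ := hx
    rfl
  · intro x _; rfl

end Partitions

/-! ## The cycle index -/

/-- The order `∏ j ^ m_j m_j!` of the centralizer of a permutation of cycle type `s`. -/
def centralizerOrder (s : Multiset ℕ) : ℕ := multProd (fun j m => j ^ m * m.factorial) s

/-- `cycleType` omits fixed points, so the parts equal to 1 are split off; they account for the
factorial of the number of fixed points. -/
theorem nat_card_centralizer_eq {n : ℕ} (w : Equiv.Perm (Fin n)) :
    Nat.card (Subgroup.centralizer {w} : Subgroup (Equiv.Perm (Fin n))) =
      centralizerOrder (cycleParts w) := by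
  have hne : ∀ a ∈ w.cycleType, a ≠ 1 := fun a ha => (Equiv.Perm.one_lt_of_mem_cycleType ha).ne'
  have h1 : (cycleParts w).count 1 = n - w.cycleType.sum := by
    rw [cycleParts, Equiv.Perm.parts_partition, Equiv.Perm.sum_cycleType, Multiset.count_add,
      Multiset.count_eq_zero.2 fun h => hne 1 h rfl]
    simp
  have h2 : (cycleParts w).filter (· ≠ 1) = w.cycleType := by
    rw [cycleParts, Equiv.Perm.parts_partition, Multiset.filter_add, Multiset.filter_eq_self.2 hne,
      Multiset.filter_eq_nil.2 fun a ha => by simp [Multiset.eq_of_mem_replicate ha], add_zero]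
  rw [Equiv.Perm.nat_card_centralizer, centralizerOrder,
    multProd_eq_mul_filter (fun j => by simp) 1, h1, h2, multProd, Finset.prod_mul_distrib,
    ← Finset.prod_multiset_count, one_pow, one_mul, Fintype.card_fin, mul_assoc]

theorem card_cycleParts_eq_mul {n : ℕ} {s : Multiset ℕ} (hs : s ∈ partsFinset n) :
    ((Finset.univ.filter fun w : Equiv.Perm (Fin n) => cycleParts w = s).card : ℂ) *
      centralizerOrder s = n.factorial := by
  obtain ⟨h1, h2⟩ := mem_partsFinset.1 hs
  obtain ⟨w, rfl⟩ := exists_cycleParts s h1 h2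
  rw [← class_card_mul w, nat_card_centralizer_eq]
  congr 3
  ext v
  simp only [Finset.mem_filter, Finset.mem_univ, true_and]
  exact ⟨fun h => by rw [h], expo_inj (fun _ => cycleParts_pos v) (fun _ => cycleParts_pos w)⟩

/-- The cycle index of `S_n`, with the variable of index `d` set to `x d`. -/
def cycleIndex (x : ℕ → SymFn) (n : ℕ) : SymFn :=
  C ((n.factorial : ℂ)⁻¹) * ∑ w : Equiv.Perm (Fin n), ((cycleParts w).map x).prod

/-- The class of cycle type `s` has `n! / z_s` elements, and both `z_s` and the monomial in the `x
j` are products over the distinct part sizes. -/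
theorem cycleIndex_eq_partGen (x : ℕ → SymFn) (n : ℕ) :
    cycleIndex x n =
      partGen (fun j m => C (((j : ℂ) ^ m * m.factorial)⁻¹) * x j ^ m) n := by
  have hfac : (n.factorial : ℂ) ≠ 0 := by exact_mod_cast n.factorial_ne_zero
  have hmem : ∀ w ∈ (Finset.univ : Finset (Equiv.Perm (Fin n))), cycleParts w ∈ partsFinset n :=
    fun w _ => mem_partsFinset.2 ⟨fun _ => cycleParts_pos w, cycleParts_sum w⟩
  rw [cycleIndex, ← Finset.sum_fiberwise_of_maps_to hmem, Finset.mul_sum, partGen]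
  refine Finset.sum_congr rfl fun s hs => ?_
  rw [Finset.sum_congr rfl fun w hw => by rw [(Finset.mem_filter.1 hw).2], Finset.sum_const,
    nsmul_eq_mul, ← map_natCast (C : ℂ →+* SymFn), ← mul_assoc, ← C_mul]
  have hz := card_cycleParts_eq_mul hs
  have hz0 : (centralizerOrder s : ℂ) ≠ 0 := fun h => hfac (by rw [← hz, h, mul_zero])
  have h1 : (n.factorial : ℂ)⁻¹ *
      ((Finset.univ.filter fun w : Equiv.Perm (Fin n) => cycleParts w = s).card : ℂ) =
      (centralizerOrder s : ℂ)⁻¹ := by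
    rw [← hz] at hfac ⊢
    have := left_ne_zero_of_mul hfac
    field_simp
  rw [h1, multProd, Finset.prod_mul_distrib, ← map_prod, Finset.prod_multiset_map_count,
    Finset.prod_inv_distrib, centralizerOrder, multProd]
  push_cast
  rfl

theorem cycleIndex_zero (x : ℕ → SymFn) : cycleIndex x 0 = 1 := by
  rw [cycleIndex_eq_partGen, partGen_zero]

/-- Newton's identities. -/
theorem mul_cycleIndex (x : ℕ → SymFn) (n : ℕ) :
    (n : SymFn) * cycleIndex x n = ∑ d ∈ Finset.Icc 1 n, x d * cycleIndex x (n - d) := by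
  simp only [cycleIndex_eq_partGen]
  -- The factor at `j` is `exp(x_j t^j / j)`, with logarithmic derivative the single term `x_j t^j`;
  -- hence only `k = 1` contributes.
  rw [mul_partGen (l := fun j k => if k = 1 then x j else 0) (fun j => by simp)]
  · refine Finset.sum_congr rfl fun d hd => ?_
    congr 1
    have hd0 := (Finset.mem_Icc.1 hd).1
    rw [Finset.sum_eq_single_of_mem (d, 1) (by simp; omega)]
    · simp
    · rintro ⟨j, k⟩ hx hne
      refine if_neg ?_
      rintro rfl
      simp only [Nat.mem_divisorsAntidiagonal, mul_one] at hx
      exact hne (by rw [hx.1])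
  · intro j hj m
    have hj' : (j : ℂ) ≠ 0 := by exact_mod_cast hj.ne'
    rcases m with _ | m
    · simp
    · rw [Finset.sum_eq_single_of_mem 1 (by simp)]
      · rw [if_pos rfl, Nat.add_sub_cancel, ← map_natCast (C : ℂ →+* SymFn) j,
          ← map_natCast (C : ℂ →+* SymFn) (m + 1), ← C_mul, ← mul_assoc, ← C_mul, pow_succ,
          Nat.factorial_succ]
        have h : ((j : ℂ) * ((m + 1 : ℕ) : ℂ)) *
            ((j : ℂ) ^ (m + 1) * (((m + 1) * m.factorial : ℕ) : ℂ))⁻¹ =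
            ((j : ℂ) ^ m * (m.factorial : ℂ))⁻¹ := by
          have h1 : ((m : ℂ) + 1) ≠ 0 := by exact_mod_cast m.succ_ne_zero
          have h2 : (m.factorial : ℂ) ≠ 0 := by exact_mod_cast m.factorial_ne_zero
          push_cast
          field_simp
          ring
        rw [← h]
        simp only [C_mul, pow_succ]
        ring_nf
      · intro k _ hk
        rw [if_neg hk, zero_mul]

/-- Fixed points contribute the factor `(-1)^0`, so they may be included. This form lets the sign be
absorbed into the power sums. -/
theorem sign_eq_prod_cycleParts {n : ℕ} (w : Equiv.Perm (Fin n)) :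
    ((Equiv.Perm.sign w : ℤ) : ℂ) = ((cycleParts w).map fun a => (-1 : ℂ) ^ (a - 1)).prod := by
  rw [cycleParts, Equiv.Perm.parts_partition, Equiv.Perm.sign_of_cycleType']
  simp only [Multiset.map_add, Multiset.prod_add, Multiset.map_replicate, Multiset.prod_replicate,
    Nat.sub_self, pow_zero, one_pow, mul_one]
  have h : ∀ s : Multiset ℕ, (∀ a ∈ s, 0 < a) →
      ((((s.map fun n => -(-1 : ℤˣ) ^ n).prod : ℤˣ) : ℤ) : ℂ) =
        (s.map fun a => (-1 : ℂ) ^ (a - 1)).prod := by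
    intro s
    induction s using Multiset.induction_on with
    | empty => simp
    | cons a s ih =>
      intro hs
      rw [Multiset.map_cons, Multiset.map_cons, Multiset.prod_cons, Multiset.prod_cons,
        ← ih fun b hb => hs b (Multiset.mem_cons_of_mem hb)]
      obtain ⟨b, rfl⟩ := Nat.exists_eq_add_of_lt (hs a (Multiset.mem_cons_self a s))
      simp [pow_succ]
  exact h _ fun a ha => (zero_lt_one.trans (Equiv.Perm.one_lt_of_mem_cycleType ha))

theorem hsymm_eq_cycleIndex (n : ℕ) : hsymm n = cycleIndex psum n := by
  simp [hsymm, ch, cycleIndex, psumProd]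

theorem esymm_eq_cycleIndex (n : ℕ) :
    esymm n = cycleIndex (fun a => (-1) ^ (a - 1) * psum a) n := by
  rw [esymm, ch, cycleIndex]
  congr 1
  refine Finset.sum_congr rfl fun w _ => ?_
  rw [Multiset.prod_map_mul, sign_eq_prod_cycleParts, map_multiset_prod, Multiset.map_map,
    psumProd]
  simp

/-! ## Powers of an `n`-cycle -/

theorem finRotate_pow_apply_val {n : ℕ} (k : ℕ) (x : Fin n) :
    ((finRotate n ^ k) x : ℕ) = (x + k) % n := by
  have : NeZero n := x.neZero
  induction k with
  | zero => simp [Nat.mod_eq_of_lt x.isLt]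
  | succ k ih =>
    rw [pow_succ', Equiv.Perm.mul_apply, finRotate_apply, Fin.val_add, ih, Fin.val_one',
      Nat.mod_add_mod, Nat.add_mod_mod, add_assoc]

theorem finRotate_pow_apply_eq_iff {n : ℕ} (k : ℕ) (x : Fin n) :
    (finRotate n ^ k) x = x ↔ n ∣ k := by
  have h : ((x : ℕ) + 0) % n = x := Nat.mod_eq_of_lt x.isLt
  rw [Fin.ext_iff, finRotate_pow_apply_val, ← Nat.modEq_zero_iff_dvd]
  refine ⟨fun h' => Nat.ModEq.add_left_cancel' (x : ℕ) ?_, fun h' => ?_⟩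
  · exact Eq.trans h' h.symm
  · exact Eq.trans (Nat.ModEq.add_left (x : ℕ) h') h

theorem dvd_mul_iff_div_gcd_dvd {n k m : ℕ} (hn : 0 < n) : n ∣ k * m ↔ n / n.gcd k ∣ m := by
  rw [Nat.div_dvd_iff_dvd_mul (Nat.gcd_dvd_left n k) (Nat.gcd_pos_of_pos_left _ hn),
    Nat.dvd_gcd_mul_iff_dvd_mul]

/-- The `k`-th power of an `n`-cycle consists of `gcd n k` cycles of the same length. -/
theorem cycleParts_finRotate_pow {n : ℕ} (hn : 0 < n) (k : ℕ) :
    cycleParts (finRotate n ^ k) = Multiset.replicate (n.gcd k) (n / n.gcd k) := by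
  have hg := Nat.gcd_pos_of_pos_left k hn
  have hmem : ∀ a ∈ cycleParts (finRotate n ^ k), a = n / n.gcd k := by
    intro a ha
    rw [cycleParts, Equiv.Perm.parts_partition, Multiset.mem_add] at ha
    rcases ha with ha | ha
    -- For `x` moved by the cycle `c`, `c ^ m` fixes `x` iff `n ∣ k * m`, that is, iff `n / gcd n k`
    -- divides `m`. So this quotient and the order of `c` have the same multiples.
    · obtain ⟨c, t, h, hd, hc, rfl⟩ := Equiv.Perm.mem_cycleType_iff.1 ha
      obtain ⟨x, hx, -⟩ := id hc
      rw [← hc.orderOf]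
      refine Nat.dvd_right_iff_eq.1 fun m => ?_
      have ht : (t ^ m) x = x := Equiv.Perm.pow_apply_eq_self_of_apply_eq_self
        ((hd x).resolve_left hx) m
      have hm : (finRotate n ^ (k * m)) x = (c ^ m) x := by
        rw [pow_mul, h, hd.commute.mul_pow, Equiv.Perm.mul_apply, ht]
      rw [orderOf_dvd_iff_pow_eq_one, hc.pow_eq_one_iff' hx, ← hm, finRotate_pow_apply_eq_iff,
        dvd_mul_iff_div_gcd_dvd hn]
    -- A fixed point forces `n ∣ k`, and then `n / gcd n k = 1`.
    · obtain rfl := Multiset.eq_of_mem_replicate ha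
      obtain ⟨x, hx⟩ : ∃ x, x ∉ (finRotate n ^ k).support := by
        by_contra! hall
        rw [Finset.eq_univ_of_forall hall] at ha
        simp at ha
      rw [Equiv.Perm.notMem_support, finRotate_pow_apply_eq_iff] at hx
      rw [Nat.gcd_eq_left hx, Nat.div_self hn]
  have hcard := Multiset.eq_replicate_card.2 hmem
  rw [hcard]
  congr 1
  -- All parts being equal, their number follows from their sum `n`.
  have hsum := cycleParts_sum (finRotate n ^ k)
  rw [hcard, Multiset.sum_replicate, smul_eq_mul] at hsum
  have hpos : 0 < n / n.gcd k := Nat.div_pos (Nat.gcd_le_left k hn) hg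
  exact Nat.eq_of_mul_eq_mul_right hpos
    (hsum.trans (Nat.mul_div_cancel' (Nat.gcd_dvd_left n k)).symm)

/-! ## The Frobenius characteristic of the twisted Lie character -/

theorem C_sign_mul_psumProd {n : ℕ} (w : Equiv.Perm (Fin n)) :
    C ((Equiv.Perm.sign w : ℤ) : ℂ) * psumProd (cycleParts w) =
      ((cycleParts w).map fun a => (-1) ^ (a - 1) * psum a).prod := by
  rw [Multiset.prod_map_mul, sign_eq_prod_cycleParts, map_multiset_prod, Multiset.map_map,
    psumProd]
  simp

theorem cycleParts_conj {n : ℕ} (g w : Equiv.Perm (Fin n)) :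
    cycleParts (g * w * g⁻¹) = cycleParts w := by
  have h : IsConj w (g * w * g⁻¹) := isConj_iff.2 ⟨g, rfl⟩
  rw [cycleParts, cycleParts, Equiv.Perm.partition_eq_of_isConj.1 h]

/-- For fixed `g` and `k`, only `w = g c^k g⁻¹` contributes, with a value independent of `g` since
cycle type and sign are conjugation invariant; the `n!` choices of `g` cancel the `1 / n!` of `ch`.
-/
theorem mul_piSym_eq_sum_range {n : ℕ} (hn : 0 < n) :
    (n : SymFn) * piSym n = ∑ k ∈ Finset.range n,
      C (Complex.exp (2 * Real.pi * Complex.I / n) ^ k) *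
        ((-1) ^ (n / n.gcd k - 1) * psum (n / n.gcd k)) ^ n.gcd k := by
  have hn0 : (n : ℂ) ≠ 0 := by exact_mod_cast hn.ne'
  have hfac : (n.factorial : ℂ) ≠ 0 := by exact_mod_cast n.factorial_ne_zero
  set ζ := Complex.exp (2 * Real.pi * Complex.I / n)
  set Φ : Equiv.Perm (Fin n) → SymFn :=
    fun w => ((cycleParts w).map fun a => (-1) ^ (a - 1) * psum a).prod with hΦ
  have h1 : ∀ w, (n : SymFn) *
      (C (((Equiv.Perm.sign w : ℤ) : ℂ) * lieChar n w) * psumProd (cycleParts w)) =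
      ∑ g : Equiv.Perm (Fin n), ∑ k ∈ Finset.range n,
        if w = g * finRotate n ^ k * g⁻¹ then C (ζ ^ k) * Φ w else 0 := by
    intro w
    have h2 : ∑ g : Equiv.Perm (Fin n), ∑ k ∈ Finset.range n,
        (if w = g * finRotate n ^ k * g⁻¹ then C (ζ ^ k) * Φ w else 0) =
        C (∑ g : Equiv.Perm (Fin n), ∑ k ∈ Finset.range n,
          if g⁻¹ * w * g = finRotate n ^ k then ζ ^ k else 0) * Φ w := by
      simp only [map_sum, Finset.sum_mul]
      refine Finset.sum_congr rfl fun g _ => Finset.sum_congr rfl fun k _ => ?_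
      have h3 : g⁻¹ * w * g = finRotate n ^ k ↔ w = g * finRotate n ^ k * g⁻¹ := by
        rw [eq_mul_inv_iff_mul_eq, mul_assoc, inv_mul_eq_iff_eq_mul]
      simp only [h3]
      split_ifs <;> simp
    rw [h2, show Φ w = _ from (C_sign_mul_psumProd w).symm, lieChar, ← map_natCast (C : ℂ →+* SymFn) n]
    simp only [C_mul]
    rw [show ∀ a b c d e : SymFn, a * (b * (c * d) * e) = (a * c) * (d * (b * e)) by
      intros; ring, ← C_mul, mul_inv_cancel₀ hn0, C_1, one_mul]
  rw [piSym, ch, mul_left_comm, Finset.mul_sum, Finset.sum_congr rfl fun w _ => h1 w,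
    Finset.sum_comm]
  have h4 : ∀ g ∈ (Finset.univ : Finset (Equiv.Perm (Fin n))),
      ∑ w : Equiv.Perm (Fin n), ∑ k ∈ Finset.range n,
        (if w = g * finRotate n ^ k * g⁻¹ then C (ζ ^ k) * Φ w else 0) =
      ∑ k ∈ Finset.range n, C (ζ ^ k) *
        ((-1) ^ (n / n.gcd k - 1) * psum (n / n.gcd k)) ^ n.gcd k := by
    intro g _
    rw [Finset.sum_comm]
    refine Finset.sum_congr rfl fun k _ => ?_
    rw [Finset.sum_ite_eq' Finset.univ, if_pos (Finset.mem_univ _), hΦ]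
    simp only [cycleParts_conj, cycleParts_finRotate_pow hn, Multiset.map_replicate,
      Multiset.prod_replicate]
  rw [Finset.sum_congr rfl h4, Finset.sum_const, nsmul_eq_mul, Finset.card_univ,
    Fintype.card_perm, Fintype.card_fin, ← map_natCast (C : ℂ →+* SymFn), ← mul_assoc, ← C_mul,
    inv_mul_cancel₀ hfac, C_1, one_mul]

/-! ### Sums over roots of unity, grouped by order -/

/-- The sum of the primitive complex `d`-th roots of unity. -/
def primRootSum (d : ℕ) : ℂ := ∑ z ∈ primitiveRoots d ℂ, z

theorem sum_nthRootsFinset_eq {M : Type*} [AddCommMonoid M] (n : ℕ) (F : ℂ → M) :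
    ∑ z ∈ Polynomial.nthRootsFinset n (1 : ℂ), F z =
      ∑ d ∈ n.divisors, ∑ z ∈ primitiveRoots d ℂ, F z := by
  classical
  rw [IsPrimitiveRoot.nthRoots_one_eq_biUnion_primitiveRoots, Finset.sum_biUnion]
  exact fun _ _ _ _ h => IsPrimitiveRoot.disjoint h

theorem sum_range_pow_eq {M : Type*} [AddCommMonoid M] {n : ℕ} (hn : 0 < n) {ζ : ℂ}
    (hζ : IsPrimitiveRoot ζ n) (F : ℂ → M) :
    ∑ k ∈ Finset.range n, F (ζ ^ k) = ∑ z ∈ Polynomial.nthRootsFinset n (1 : ℂ), F z := by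
  refine Finset.sum_bij (fun k _ => ζ ^ k) ?_ ?_ ?_ ?_
  · intro k _
    rw [Polynomial.mem_nthRootsFinset hn, ← pow_mul, mul_comm, pow_mul, hζ.pow_eq_one, one_pow]
  · intro a ha b hb h
    exact hζ.pow_inj (Finset.mem_range.1 ha) (Finset.mem_range.1 hb) h
  · intro z hz
    have : NeZero n := ⟨hn.ne'⟩
    obtain ⟨k, hk, h⟩ := hζ.eq_pow_of_pow_eq_one ((Polynomial.mem_nthRootsFinset hn _).1 hz)
    exact ⟨k, Finset.mem_range.2 hk, h⟩
  · intro _ _; rfl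

/-- The left side is the sum of all `n`-th roots of unity. This is the defining identity of the
Möbius function; individual values of `primRootSum` beyond `d = 1` are not needed. -/
theorem sum_primRootSum (n : ℕ) :
    ∑ d ∈ n.divisors, primRootSum d = if n = 1 then 1 else 0 := by
  rcases Nat.eq_zero_or_pos n with rfl | hn
  · simp
  have h := sum_nthRootsFinset_eq n (fun z : ℂ => z)
  have hζ := Complex.isPrimitiveRoot_exp n hn.ne'
  rw [← sum_range_pow_eq hn hζ] at h
  simp only [primRootSum]
  rw [← h]
  split_ifs with h1
  · subst h1; simp
  · exact hζ.geom_sum_eq_zero (by omega)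

/-- The order `n / gcd n k` of `ζ ^ k` is also the cycle length of the `k`-th power of the
`n`-cycle, so the summand is a function of the root of unity alone, and the roots of each order can
be collected. -/
theorem mul_piSym {n : ℕ} (hn : 0 < n) :
    (n : SymFn) * piSym n = ∑ x ∈ n.divisorsAntidiagonal,
      C (primRootSum x.1) * ((-1) ^ (x.1 - 1) * psum x.1) ^ x.2 := by
  have hζ := Complex.isPrimitiveRoot_exp n hn.ne'
  rw [mul_piSym_eq_sum_range hn, Nat.sum_divisorsAntidiagonal fun a b =>
    C (primRootSum a) * ((-1) ^ (a - 1) * psum a) ^ b]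
  set F : ℂ → SymFn :=
    fun z => C z * ((-1) ^ (orderOf z - 1) * psum (orderOf z)) ^ (n / orderOf z) with hF
  have h : ∀ k ∈ Finset.range n, C (Complex.exp (2 * Real.pi * Complex.I / n) ^ k) *
        ((-1) ^ (n / n.gcd k - 1) * psum (n / n.gcd k)) ^ n.gcd k =
      F (Complex.exp (2 * Real.pi * Complex.I / n) ^ k) := by
    intro k _
    have : orderOf (Complex.exp (2 * Real.pi * Complex.I / n) ^ k) = n / n.gcd k := by
      rw [(isOfFinOrder_iff_pow_eq_one.2 ⟨n, hn, hζ.pow_eq_one⟩).orderOf_pow, ← hζ.eq_orderOf]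
    simp only [hF, this, Nat.div_div_self (Nat.gcd_dvd_left n k) hn.ne']
  rw [Finset.sum_congr rfl h, sum_range_pow_eq hn hζ, sum_nthRootsFinset_eq]
  refine Finset.sum_congr rfl fun d _ => ?_
  rw [primRootSum, map_sum, Finset.sum_mul]
  refine Finset.sum_congr rfl fun z hz => ?_
  simp only [hF, ← (isPrimitiveRoot_of_mem_primitiveRoots hz).eq_orderOf]

/-! ## Plethysm -/

/-- The Adams operation `g ↦ p_d[g]`. -/
def adams (d : ℕ+) : SymFn →ₐ[ℂ] SymFn := aeval fun k : ℕ+ => X (d * k)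

/-- Plethysm by `g` as an algebra homomorphism. -/
def plethysmHom (g : SymFn) : SymFn →ₐ[ℂ] SymFn := aeval fun m : ℕ+ => adams m g

theorem plethysmHom_apply (f g : SymFn) : plethysmHom g f = plethysm f g := rfl

theorem plethysmHom_psum (g : SymFn) (d : ℕ) : plethysmHom g (psum d) = adams d.toPNat' g := by
  simp [plethysmHom, psum]

theorem adams_psum {d k : ℕ} (hd : 0 < d) (hk : 0 < k) :
    adams d.toPNat' (psum k) = psum (d * k) := by
  have h : d.toPNat' * k.toPNat' = (d * k).toPNat' := by
    apply PNat.eq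
    simp [Nat.toPNat'_coe, hd, hk]
  simp [adams, psum, h]

/-- Newton's identities survive any algebra homomorphism. -/
theorem mul_plethysmHom_cycleIndex (g : SymFn) (x : ℕ → SymFn) (n : ℕ) :
    (n : SymFn) * plethysmHom g (cycleIndex x n) = ∑ d ∈ Finset.Icc 1 n,
      plethysmHom g (x d) * plethysmHom g (cycleIndex x (n - d)) := by
  have h := congrArg (plethysmHom g) (mul_cycleIndex x n)
  simpa only [map_mul, map_natCast, map_sum] using h

theorem mul_plethysm_hsymm (g : SymFn) (n : ℕ) :
    (n : SymFn) * plethysm (hsymm n) g = ∑ d ∈ Finset.Icc 1 n,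
      adams d.toPNat' g * plethysm (hsymm (n - d)) g := by
  have h := mul_plethysmHom_cycleIndex g psum n
  simp only [plethysmHom_psum, ← hsymm_eq_cycleIndex] at h
  exact h

theorem mul_plethysm_esymm (g : SymFn) (n : ℕ) :
    (n : SymFn) * plethysm (esymm n) g = ∑ d ∈ Finset.Icc 1 n,
      (-1) ^ (d - 1) * adams d.toPNat' g * plethysm (esymm (n - d)) g := by
  have h := mul_plethysmHom_cycleIndex g (fun a => (-1) ^ (a - 1) * psum a) n
  simp only [map_mul, map_pow, map_neg, map_one, plethysmHom_psum, ← esymm_eq_cycleIndex] at h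
  exact h

/-! ## The signed contribution of the parts of size `j` -/

/-- The factor of `(-1) ^ rank λ • ch W_λ` contributed by `m` parts of size `j`; parts of size `1`
are not allowed. -/
def signedFactor (j m : ℕ) : SymFn :=
  if j = 1 then (if m = 0 then 1 else 0)
  else (-1) ^ ((j - 1) * m) *
    if Odd j then plethysm (hsymm m) (piSym j) else plethysm (esymm m) (piSym j)

/-- The coefficients of the logarithmic derivative of `signedFactor j`. -/
def signedLog (j k : ℕ) : SymFn :=
  if j = 1 then 0 else (-1) ^ (j - 1) * (j * adams k.toPNat' (piSym j))

theorem signedFactor_zero (j : ℕ) : signedFactor j 0 = 1 := by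
  simp [signedFactor, hsymm_eq_cycleIndex, esymm_eq_cycleIndex, cycleIndex_zero,
    ← plethysmHom_apply]

/-- For `j ≥ 2` this is Newton's identity for `h_m[π_j]` or `e_m[π_j]`, scaled by `j`. For even `j`
the rank sign is `(-1)^m`, and `(-1)^m e_m` obeys the recurrence of `h_m` with all power sums
negated. -/
theorem mul_signedFactor {j : ℕ} (hj : 0 < j) (m : ℕ) :
    (j * m : SymFn) * signedFactor j m =
      ∑ k ∈ Finset.Icc 1 m, signedLog j k * signedFactor j (m - k) := by
  rcases eq_or_ne j 1 with rfl | hj1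
  · rcases Nat.eq_zero_or_pos m with rfl | hm
    · simp
    · simp [signedFactor, signedLog, hm.ne']
  simp only [signedFactor, signedLog, if_neg hj1]
  rcases Nat.even_or_odd j with he | ho
  · have ho : Odd (j - 1) := Nat.Even.sub_odd hj he odd_one
    simp only [if_neg (Nat.not_odd_iff_even.2 he), pow_mul, ho.neg_one_pow]
    rw [show ∀ a b c d : SymFn, a * b * (c * d) = a * c * (b * d) by intros; ring,
      mul_plethysm_esymm, Finset.mul_sum]
    refine Finset.sum_congr rfl fun k hk => ?_
    obtain ⟨h1, h2⟩ := Finset.mem_Icc.1 hk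
    obtain ⟨k, rfl⟩ := Nat.exists_eq_add_of_le' h1
    obtain ⟨i, rfl⟩ := Nat.exists_eq_add_of_le h2
    rw [Nat.add_sub_cancel, Nat.add_sub_cancel_left]
    -- With `m = k + 1 + i`, the sign of `e_m` and the sign in Newton's identity leave the sign of
    -- `e_i` and one overall minus.
    have h3 : (-1 : SymFn) ^ (k + 1 + i) * (-1) ^ k = -1 * (-1) ^ i := by
      rw [← pow_add, show k + 1 + i + k = 2 * k + (i + 1) by ring, pow_add, pow_mul]
      simp [pow_succ]
    linear_combination (j : SymFn) * adams (k + 1).toPNat' (piSym j) *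
      plethysm (esymm i) (piSym j) * h3
  · have he : Even (j - 1) := Nat.Odd.sub_odd ho odd_one
    simp only [if_pos ho, pow_mul, he.neg_one_pow, one_pow, one_mul]
    rw [mul_assoc, mul_plethysm_hsymm, Finset.mul_sum]
    exact Finset.sum_congr rfl fun k _ => by ring

/-! ### Möbius cancellation in the logarithmic derivative -/

theorem mul_adams_piSym {j k : ℕ} (hj : 0 < j) (hk : 0 < k) :
    (j : SymFn) * adams k.toPNat' (piSym j) = ∑ x ∈ j.divisorsAntidiagonal,
      C (primRootSum x.1) * ((-1) ^ (x.1 - 1) * psum (x.1 * k)) ^ x.2 := by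
  have h := congrArg (adams k.toPNat') (mul_piSym hj)
  rw [map_mul, map_natCast, map_sum] at h
  rw [h]
  refine Finset.sum_congr rfl fun x hx => ?_
  have hx1 : 0 < x.1 := Nat.pos_of_mem_divisors (Nat.fst_mem_divisors_of_mem_antidiagonal hx)
  rw [map_mul, map_pow, map_mul, adams_psum hk hx1, map_pow, map_neg, map_one, mul_comm k,
    ← algebraMap_eq, AlgHom.commutes]

/-- Expanding `π_j` turns the sum into one over `a b k = d` of `μ(a) (-1)^{b-1} p_{ak}^b`. For fixed
`N = a k` the coefficients `μ(a)` run over the divisors of `N` and cancel unless `N = 1`, which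
leaves `b = d`. -/
theorem sum_mul_adams_piSym {d : ℕ} (hd : 0 < d) :
    ∑ x ∈ d.divisorsAntidiagonal, (-1) ^ (x.1 - 1) * (x.1 * adams x.2.toPNat' (piSym x.1)) =
      (-1) ^ (d - 1) * psum 1 ^ d := by
  have h1 : ∀ x ∈ d.divisorsAntidiagonal,
      (-1) ^ (x.1 - 1) * (x.1 * adams x.2.toPNat' (piSym x.1)) =
      ∑ y ∈ x.1.divisorsAntidiagonal,
        C (primRootSum y.1) * ((-1) ^ (y.2 - 1) * psum (y.1 * x.2) ^ y.2) := by
    intro x hx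
    obtain ⟨hx1, hx0⟩ := Nat.mem_divisorsAntidiagonal.1 hx
    rw [← hx1] at hx0
    rw [mul_adams_piSym (Nat.pos_of_ne_zero (left_ne_zero_of_mul hx0))
      (Nat.pos_of_ne_zero (right_ne_zero_of_mul hx0)), Finset.mul_sum]
    refine Finset.sum_congr rfl fun y hy => ?_
    obtain ⟨hy1, hy0⟩ := Nat.mem_divisorsAntidiagonal.1 hy
    rw [← hy1] at hy0
    obtain ⟨a, ha⟩ := Nat.exists_eq_succ_of_ne_zero (left_ne_zero_of_mul hy0)
    obtain ⟨b, hb⟩ := Nat.exists_eq_succ_of_ne_zero (right_ne_zero_of_mul hy0)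
    -- With `x.1 = a b`, the exponents satisfy `(ab - 1) + (a - 1) b = 2 (a - 1) b + (b - 1)`.
    have h3 : (-1 : SymFn) ^ (x.1 - 1) * (-1) ^ ((y.1 - 1) * y.2) = (-1) ^ (y.2 - 1) := by
      rw [← hy1, ha, hb, ← pow_add]
      have : (a.succ * b.succ - 1) + (a.succ - 1) * b.succ = 2 * (a * b.succ) + (b.succ - 1) := by
        simp only [Nat.succ_eq_add_one, Nat.add_sub_cancel]
        have : (a + 1) * (b + 1) - 1 = a * (b + 1) + b := by
          rw [add_mul, one_mul, ← add_assoc, Nat.add_sub_cancel]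
        rw [this]; ring
      rw [this, pow_add, pow_mul]
      simp
    rw [mul_pow, ← pow_mul, ← h3]
    ring
  rw [Finset.sum_congr rfl h1, Finset.sum_sigma']
  have h2 : ∑ x ∈ d.divisorsAntidiagonal.sigma fun x => x.1.divisorsAntidiagonal,
      C (primRootSum x.2.1) * ((-1) ^ (x.2.2 - 1) * psum (x.2.1 * x.1.2) ^ x.2.2) =
      ∑ x ∈ d.divisorsAntidiagonal.sigma fun x => x.1.divisorsAntidiagonal,
        C (primRootSum x.2.1) * ((-1) ^ (x.1.2 - 1) * psum x.1.1 ^ x.1.2) := by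
    -- On triples `(a, b, k)` this exchanges `b` and `k`, hence is its own inverse; the outer pair
    -- changes from `(ab, k)` to `(ak, b)`.
    refine Finset.sum_bij' (fun x _ => ⟨(x.2.1 * x.1.2, x.2.2), (x.2.1, x.1.2)⟩)
      (fun x _ => ⟨(x.2.1 * x.1.2, x.2.2), (x.2.1, x.1.2)⟩) ?_ ?_ ?_ ?_ ?_
    · rintro ⟨⟨j, k⟩, ⟨a, b⟩⟩ hx
      simp only [Finset.mem_sigma, Nat.mem_divisorsAntidiagonal] at hx ⊢
      obtain ⟨⟨rfl, h0⟩, rfl, h0'⟩ := hx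
      refine ⟨⟨by ring, h0⟩, trivial, ?_⟩
      exact mul_ne_zero (left_ne_zero_of_mul h0') (right_ne_zero_of_mul h0)
    · rintro ⟨⟨j, k⟩, ⟨a, b⟩⟩ hx
      simp only [Finset.mem_sigma, Nat.mem_divisorsAntidiagonal] at hx ⊢
      obtain ⟨⟨rfl, h0⟩, rfl, h0'⟩ := hx
      refine ⟨⟨by ring, h0⟩, trivial, ?_⟩
      exact mul_ne_zero (left_ne_zero_of_mul h0') (right_ne_zero_of_mul h0)
    · rintro ⟨⟨j, k⟩, ⟨a, b⟩⟩ hx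
      simp only [Finset.mem_sigma, Nat.mem_divisorsAntidiagonal] at hx
      obtain ⟨⟨rfl, h0⟩, rfl, h0'⟩ := hx
      rfl
    · rintro ⟨⟨j, k⟩, ⟨a, b⟩⟩ hx
      simp only [Finset.mem_sigma, Nat.mem_divisorsAntidiagonal] at hx
      obtain ⟨⟨rfl, h0⟩, rfl, h0'⟩ := hx
      rfl
    · intro x _; rfl
  rw [h2, Finset.sum_sigma, Finset.sum_eq_single_of_mem (1, d) (by simp [hd.ne'])]
  · simp [primRootSum]
  · rintro ⟨N, b⟩ hx hne
    have hN : N ≠ 1 := by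
      rintro rfl
      simp only [Nat.mem_divisorsAntidiagonal, one_mul] at hx
      exact hne (by rw [hx.1])
    simp only
    rw [← Finset.sum_mul, Nat.sum_divisorsAntidiagonal fun a _ => (C (primRootSum a) : SymFn),
      ← map_sum, sum_primRootSum, if_neg hN, C_0, zero_mul]

theorem piSym_one : piSym 1 = psum 1 := by
  have h := mul_piSym one_pos
  have h1 : primRootSum 1 = 1 := by simpa using sum_primRootSum 1
  simpa [h1] using h

/-- Forbidding parts of size 1 removes the term `j = 1`, which is `p_d[π_1] = p_d`. -/
theorem sum_signedLog {d : ℕ} (hd : 0 < d) :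
    ∑ x ∈ d.divisorsAntidiagonal, signedLog x.1 x.2 = (-1) ^ (d - 1) * psum 1 ^ d - psum d := by
  have hmem : (1, d) ∈ d.divisorsAntidiagonal := by simp [hd.ne']
  rw [← sum_mul_adams_piSym hd, ← Finset.add_sum_erase _ _ hmem, ← Finset.add_sum_erase _ _ hmem]
  have h1 : signedLog 1 d = 0 := if_pos rfl
  have h2 : adams d.toPNat' (piSym 1) = psum d := by
    rw [piSym_one, adams_psum hd one_pos, mul_one]
  simp only [h1, h2, Nat.sub_self, pow_zero, Nat.cast_one, one_mul, zero_add, add_sub_cancel_left]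
  refine Finset.sum_congr rfl fun x hx => if_neg fun h => ?_
  obtain ⟨hne, hx⟩ := Finset.mem_erase.1 hx
  obtain ⟨j, k⟩ := x
  simp only at h
  subst h
  simp only [Nat.mem_divisorsAntidiagonal, one_mul] at hx
  exact hne (by rw [hx.1])

/-! ## Logarithmic derivatives of power series -/

section PowerSeries

variable {R : Type*} [CommRing R]

theorem X_mul_derivative_mk {L u : ℕ → R} (hL : L 0 = 0)
    (h : ∀ n : ℕ, (n : R) * u n = ∑ d ∈ Finset.Icc 1 n, L d * u (n - d)) :
    PowerSeries.X * PowerSeries.derivative R (PowerSeries.mk u) =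
      PowerSeries.mk L * PowerSeries.mk u := by
  ext n
  have h1 : PowerSeries.coeff n (PowerSeries.X * PowerSeries.derivative R (PowerSeries.mk u)) =
      (n : R) * u n := by
    rcases n with _ | n
    · simp
    · rw [PowerSeries.coeff_succ_X_mul, PowerSeries.coeff_derivative, PowerSeries.coeff_mk]
      push_cast
      ring
  rw [h1, h, PowerSeries.coeff_mul]
  simp only [PowerSeries.coeff_mk]
  rw [Finset.Nat.sum_antidiagonal_eq_sum_range_succ fun i j => L i * u j]
  -- The recurrence starts at `d = 1`, the Cauchy product at `d = 0`; the extra term vanishes by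
  -- `hL`.
  refine Finset.sum_subset (fun d hd => ?_) fun d hd hd' => ?_
  · simp only [Finset.mem_Icc, Finset.mem_range] at hd ⊢
    omega
  · have : d = 0 := by
      simp only [Finset.mem_Icc, Finset.mem_range] at hd hd'
      omega
    rw [this, hL, zero_mul]

/-- A power series is determined by its constant coefficient and its logarithmic derivative. -/
theorem eq_of_X_mul_derivative_eq [IsDomain R] [CharZero R] {L U V : PowerSeries R}
    (hL : PowerSeries.coeff 0 L = 0) (h0 : PowerSeries.coeff 0 U = PowerSeries.coeff 0 V)
    (hU : PowerSeries.X * PowerSeries.derivative R U = L * U)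
    (hV : PowerSeries.X * PowerSeries.derivative R V = L * V) : U = V := by
  ext n
  induction n using Nat.strong_induction_on with
  | _ n ih =>
    rcases n with _ | n
    · exact h0
    · have h1 := congrArg (PowerSeries.coeff (n + 1)) hU
      have h2 := congrArg (PowerSeries.coeff (n + 1)) hV
      rw [PowerSeries.coeff_succ_X_mul, PowerSeries.coeff_derivative, PowerSeries.coeff_mul] at h1 h2
      have h3 : ∑ p ∈ Finset.HasAntidiagonal.antidiagonal (n + 1),
          PowerSeries.coeff p.1 L * PowerSeries.coeff p.2 U =
          ∑ p ∈ Finset.HasAntidiagonal.antidiagonal (n + 1),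
            PowerSeries.coeff p.1 L * PowerSeries.coeff p.2 V := by
        -- As `L` has no constant term, the coefficient of index `n + 1` does not occur on the
        -- right, so the induction hypothesis covers every remaining term.
        refine Finset.sum_congr rfl fun p hp => ?_
        have hp := Finset.HasAntidiagonal.mem_antidiagonal.1 hp
        rcases Nat.eq_zero_or_pos p.1 with h | h
        · rw [h, hL, zero_mul, zero_mul]
        · rw [ih p.2 (by omega)]
      have hn : ((n : R) + 1) ≠ 0 := by exact_mod_cast n.succ_ne_zero
      exact mul_right_cancel₀ hn (h1.trans (h3.trans h2.symm))

end PowerSeries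

/-! ## The alternating sum -/

theorem esymm_zero : esymm 0 = 1 := by rw [esymm_eq_cycleIndex, cycleIndex_zero]

theorem esymm_one : esymm 1 = psum 1 := by
  have h := mul_cycleIndex (fun a => (-1) ^ (a - 1) * psum a) 1
  rw [← esymm_eq_cycleIndex] at h
  simpa [cycleIndex_zero] using h

/-- The logarithmic derivative of `∑ (-1)^n e_n t^n = exp(-∑ p_d t^d / d)`, as a recurrence. -/
theorem mul_signed_esymm (n : ℕ) :
    (n : SymFn) * ((-1) ^ n * esymm n) =
      ∑ d ∈ Finset.Icc 1 n, -psum d * ((-1) ^ (n - d) * esymm (n - d)) := by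
  have h := mul_cycleIndex (fun a => (-1) ^ (a - 1) * psum a) n
  simp only [← esymm_eq_cycleIndex] at h
  rw [mul_left_comm, h, Finset.mul_sum]
  refine Finset.sum_congr rfl fun d hd => ?_
  obtain ⟨h1, h2⟩ := Finset.mem_Icc.1 hd
  obtain ⟨k, rfl⟩ := Nat.exists_eq_add_of_le' h1
  obtain ⟨i, rfl⟩ := Nat.exists_eq_add_of_le h2
  rw [Nat.add_sub_cancel, Nat.add_sub_cancel_left]
  have h3 : (-1 : SymFn) ^ (k + 1 + i) * (-1) ^ k = -1 * (-1) ^ i := by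
    rw [← pow_add, show k + 1 + i + k = 2 * k + (i + 1) by ring, pow_add, pow_mul]
    simp [pow_succ]
  linear_combination psum (k + 1) * esymm i * h3

/-- Both sides have constant coefficient 1 and logarithmic derivative `A + P`: `A` is that of `1 +
p_1 t` and `P` that of the signed series of the `e_n`. -/
theorem mk_partGen_signedFactor :
    PowerSeries.mk (partGen signedFactor) = (1 + PowerSeries.C (psum 1) * PowerSeries.X) *
      PowerSeries.mk (fun n => (-1) ^ n * esymm n) := by
  set E : PowerSeries SymFn := PowerSeries.mk (fun n => (-1) ^ n * esymm n) with hE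
  set A : PowerSeries SymFn :=
    PowerSeries.mk (fun d => if d = 0 then 0 else (-1) ^ (d - 1) * psum 1 ^ d) with hA
  set P : PowerSeries SymFn := PowerSeries.mk (fun d => if d = 0 then 0 else -psum d) with hP
  -- `A` is the geometric expansion of `p_1 t / (1 + p_1 t)`; the denominator is cleared.
  have hAX : A * (1 + PowerSeries.C (psum 1) * PowerSeries.X) =
      PowerSeries.C (psum 1) * PowerSeries.X := by
    rw [show A * (1 + PowerSeries.C (psum 1) * PowerSeries.X) =
      A + PowerSeries.C (psum 1) * (A * PowerSeries.X) by ring]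
    ext1 n
    rcases n with _ | _ | n
    · simp [hA]
    · simp [hA, PowerSeries.coeff_succ_mul_X]
    · rw [map_add, PowerSeries.coeff_C_mul, PowerSeries.coeff_succ_mul_X, PowerSeries.coeff_C_mul,
        PowerSeries.coeff_X, hA, PowerSeries.coeff_mk, PowerSeries.coeff_mk]
      simp [pow_succ]
      ring
  have hDE : PowerSeries.X * PowerSeries.derivative SymFn E = P * E := by
    refine X_mul_derivative_mk (if_pos rfl) fun n => ?_
    rw [mul_signed_esymm]
    refine Finset.sum_congr rfl fun d hd => ?_
    have := (Finset.mem_Icc.1 hd).1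
    rw [if_neg (by omega)]
  refine eq_of_X_mul_derivative_eq (L := A + P) ?_ ?_ ?_ ?_
  · simp [hA, hP]
  · simp [partGen_zero, hE, esymm_zero]
  · have hAP : A + P = PowerSeries.mk fun d =>
        ∑ x ∈ d.divisorsAntidiagonal, signedLog x.1 x.2 := by
      ext1 d
      rw [map_add, hA, hP, PowerSeries.coeff_mk, PowerSeries.coeff_mk, PowerSeries.coeff_mk]
      rcases Nat.eq_zero_or_pos d with rfl | hd
      · simp
      · rw [if_neg hd.ne', if_neg hd.ne', sum_signedLog hd, sub_eq_add_neg]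
    rw [hAP]
    exact X_mul_derivative_mk (by simp)
      (mul_partGen signedFactor_zero fun j hj m => mul_signedFactor hj m)
  · rw [Derivation.leibniz, map_add, Derivation.leibniz, PowerSeries.derivative_X,
      PowerSeries.derivative_C, PowerSeries.derivative_one]
    simp only [smul_eq_mul]
    linear_combination (1 + PowerSeries.C (psum 1) * PowerSeries.X) * hDE - E * hAX

theorem partGen_signedFactor_add_two (k : ℕ) :
    partGen signedFactor (k + 2) = (-1) ^ (k + 1) * (esymm (k + 1) * esymm 1 - esymm (k + 2)) := by
  have h := congrArg (PowerSeries.coeff (k + 2)) mk_partGen_signedFactor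
  rw [PowerSeries.coeff_mk, add_mul, one_mul, map_add, mul_assoc, PowerSeries.coeff_C_mul,
    PowerSeries.coeff_succ_X_mul, PowerSeries.coeff_mk, PowerSeries.coeff_mk] at h
  rw [h, esymm_one]
  ring

/-! ## The Schur function of the shape `(2, 1 ^ k)` -/

theorem mem_hookTwo {k : ℕ} {c : ℕ × ℕ} :
    c ∈ hookTwo k ↔ (c.1 = 0 ∧ c.2 < 2) ∨ (0 < c.1 ∧ c.1 ≤ k ∧ c.2 = 0) := by
  obtain ⟨i, j⟩ := c
  rw [hookTwo, YoungDiagram.mem_ofRowLens]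
  rcases i with _ | i
  · simp
  · simp only [List.length_cons, List.length_replicate, List.getElem_cons_succ,
      List.getElem_replicate, Nat.lt_one_iff, exists_prop]
    constructor
    · rintro ⟨h1, h2⟩
      exact Or.inr ⟨i.succ_pos, by lia, h2⟩
    · rintro (⟨h1, -⟩ | ⟨-, h1, h2⟩)
      · exact absurd h1 i.succ_ne_zero
      · exact ⟨by lia, h2⟩

/-- The columns have lengths `k + 1` and `1`, so the determinant has rows `(e_{k+1}, e_{k+2})` and
`(e_0, e_1)`. -/
theorem schur_hookTwo (k : ℕ) :
    schur (hookTwo k) = esymm (k + 1) * esymm 1 - esymm (k + 2) := by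
  have hrow : (hookTwo k).rowLen 0 = 2 := by
    refine eq_of_forall_lt_iff fun j => ?_
    rw [← YoungDiagram.mem_iff_lt_rowLen, mem_hookTwo]
    simp
  have hcol0 : (hookTwo k).colLen 0 = k + 1 := by
    refine eq_of_forall_lt_iff fun j => ?_
    rw [← YoungDiagram.mem_iff_lt_colLen, mem_hookTwo]
    simp
    omega
  have hcol1 : (hookTwo k).colLen 1 = 1 := by
    refine eq_of_forall_lt_iff fun j => ?_
    rw [← YoungDiagram.mem_iff_lt_colLen, mem_hookTwo]
    simp
  have hZ : ∀ (z : ℤ) (m : ℕ), z = m → esymmZ z = esymm m := by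
    rintro _ m rfl
    simp [esymmZ]
  rw [schur, hrow, Matrix.det_fin_two]
  simp only [Matrix.of_apply, Fin.val_zero, Fin.val_one, hcol0, hcol1]
  rw [hZ _ (k + 1) (by push_cast; ring), hZ _ 1 (by norm_num), hZ _ (k + 2) (by push_cast; ring),
    hZ _ 0 (by norm_num), esymm_zero, mul_one]

/-! ## The characters -/

/-- `chInv` as a linear map. -/
def chInvLinear (n : ℕ) : SymFn →ₗ[ℂ] (Equiv.Perm (Fin n) → ℂ) where
  toFun := chInv n
  map_add' F G := by
    funext w
    simp [chInv, mul_add]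
  map_smul' c F := by
    funext w
    simp [chInv, mul_left_comm]

/-- The rank is additive over part sizes: `m` parts `j` contribute `(j - 1) m`. Sizes that do not
occur contribute the factor 1, so the product over `1, …, n` reduces to the parts present. -/
theorem neg_one_pow_partRank_mul_wSym {n : ℕ} (lam : n.Partition) (h : 1 ∉ lam.parts) :
    (-1) ^ partRank lam * wSym lam = multProd signedFactor lam.parts := by
  have hsub : lam.parts.toFinset ⊆ Finset.Icc 1 n := fun j hj => by
    rw [Multiset.mem_toFinset] at hj
    refine Finset.mem_Icc.2 ⟨lam.parts_pos hj, ?_⟩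
    rw [← lam.parts_sum]
    exact Multiset.le_sum_of_mem hj
  have hrank : partRank lam = ∑ j ∈ Finset.Icc 1 n, (j - 1) * lam.parts.count j := by
    rw [partRank, Finset.sum_multiset_map_count]
    refine (Finset.sum_congr rfl fun j _ => ?_).trans (Finset.sum_subset hsub fun j _ hj => ?_)
    · rw [smul_eq_mul, mul_comm]
    · rw [Multiset.count_eq_zero.2 (by simpa using hj), mul_zero]
  rw [hrank, ← Finset.prod_pow_eq_pow_sum, wSym, ← Finset.prod_mul_distrib, multProd]
  symm
  refine (Finset.prod_subset hsub fun j _ hj => ?_).trans (Finset.prod_congr rfl fun j _ => ?_)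
  · rw [Multiset.count_eq_zero.2 (by simpa using hj), signedFactor_zero]
  · rw [signedFactor]
    split_ifs with h1 h2 h3 h3
    · subst h1
      simp [h2, hsymm_eq_cycleIndex, cycleIndex_zero, ← plethysmHom_apply]
    all_goals first | rfl | skip
    all_goals
      subst h1
      first
      | exact absurd (Multiset.count_eq_zero.2 h) h2
      | exact absurd odd_one h3

/-- A partition with a part 1 is killed by `signedFactor 1 m = 0` for `m > 0`. -/
theorem partGen_signedFactor (n : ℕ) :
    partGen signedFactor n = ∑ lam : n.Partition with 1 ∉ lam.parts,
      (-1) ^ partRank lam * wSym lam := by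
  rw [partGen, sum_partsFinset, Finset.sum_filter]
  refine Finset.sum_congr rfl fun lam _ => ?_
  split_ifs with h
  · rw [multProd]
    have h1 := Multiset.count_pos.2 h
    exact Finset.prod_eq_zero (Multiset.mem_toFinset.2 h) (by simp [signedFactor, h1.ne'])
  · rw [neg_one_pow_partRank_mul_wSym lam h]

theorem partRank_le {n : ℕ} (lam : n.Partition) : partRank lam ≤ n := by
  conv_rhs => rw [← lam.parts_sum]
  conv_rhs => rw [← Multiset.map_id lam.parts]
  exact Multiset.sum_map_le_sum_map _ _ fun a _ => Nat.sub_le a 1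

theorem support_wHat_subset (n : ℕ) :
    (Function.support fun i : ℕ => wHat n i) ⊆ Finset.range (n + 1) := by
  intro i hi
  by_contra hni
  refine hi ?_
  simp only
  rw [wHat, Finset.filter_eq_empty_iff.2, Finset.sum_empty]
  rintro lam - ⟨-, rfl⟩
  exact hni (by simpa using Nat.lt_succ_of_le (partRank_le lam))

/-- Partitions are grouped by rank, and linearity of `chInv` moves the whole alternating sum to
symmetric functions. -/
theorem sum_wHat (n : ℕ) :
    ∑ i ∈ Finset.range (n + 1), (-1 : ℂ) ^ i • wHat n i = chInv n (partGen signedFactor n) := by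
  have hmem : ∀ lam ∈ Finset.univ.filter (fun lam : n.Partition => 1 ∉ lam.parts),
      partRank lam ∈ Finset.range (n + 1) :=
    fun lam _ => Finset.mem_range.2 (Nat.lt_succ_of_le (partRank_le lam))
  change _ = chInvLinear n _
  rw [partGen_signedFactor, map_sum, ← Finset.sum_fiberwise_of_maps_to hmem]
  refine Finset.sum_congr rfl fun i _ => ?_
  rw [wHat, Finset.smul_sum, Finset.filter_filter]
  refine Finset.sum_congr rfl fun lam hlam => ?_
  rw [(Finset.mem_filter.1 hlam).2.2]
  have : ((-1) ^ i * wSym lam : SymFn) = ((-1 : ℂ) ^ i) • wSym lam := by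
    rw [smul_eq_C_mul]; simp
  rw [this, map_smul]
  rfl

end SymmChar

end

/-! ### Conclusion: back from symmetric functions to characters -/

theorem theorem1p5 (n : ℕ) (hn : 2 ≤ n) :
    (Function.support (fun i : ℕ => SymmChar.wHat n i)).Finite ∧
      ∑ᶠ i : ℕ, (-1 : ℂ) ^ i • SymmChar.wHat n i =
        (-1 : ℂ) ^ (n - 1) • SymmChar.irrChar n (SymmChar.hookTwo (n - 2)) := by
  have hsub := SymmChar.support_wHat_subset n
  refine ⟨(Finset.finite_toSet _).subset hsub, ?_⟩
  rw [finsum_eq_sum_of_support_subset (fun i : ℕ => (-1 : ℂ) ^ i • SymmChar.wHat n i)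
    ((Function.support_smul_subset_right (fun i : ℕ => (-1 : ℂ) ^ i) _).trans hsub),
    SymmChar.sum_wHat]
  -- Writing `n = k + 2` turns the truncated `n - 2` and `n - 1` into `k` and `k + 1`.
  obtain ⟨k, rfl⟩ := Nat.exists_eq_add_of_le' hn
  rw [SymmChar.partGen_signedFactor_add_two, Nat.add_sub_cancel, ← SymmChar.schur_hookTwo,
    SymmChar.irrChar]
  have : ((-1) ^ (k + 1) * SymmChar.schur (SymmChar.hookTwo k) : SymmChar.SymFn) =
      ((-1 : ℂ) ^ (k + 1)) • SymmChar.schur (SymmChar.hookTwo k) := by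
    rw [MvPolynomial.smul_eq_C_mul]; simp
  rw [this]
  exact (SymmChar.chInvLinear (k + 2)).map_smul _ _
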